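/- **Base graph and CFI graphs.** For $n\ge 3$ let $G_n^2$ be the $2\times n$ grid graph with one additional vertex attached by a single edge to one of its corners. For a base graph $G$, the graph $X(G)$ is defined as follows: every vertex $v$ of $G$ of degree $d$ is replaced by a gadget consisting of all tuples in $\{0,1\}^d$ with an even number of ones, the coordinates being indexed by the edges of $G$ incident to $v$; there are no edges inside a gadget, and for every edge $e=\{u,v\}$ of $G$, a tuple $a$ in the gadget of $u$ is joined to a tuple $b$ in the gadget of $v$ if and only if $a_e=b_e$. The graph $\tilde X(G)$ is obtained from $X(G)$ by twisting one arbitrary edge $e=\{u,v\}$ of $G$, that is, by exchanging edges and nonedges between the gadget of $u$ and the gadget of $v$. **Walk counting logic.** For $k\in\mathbb N$, the $k$-walk counting logic has a set of $k+1$ variables, interpreted as vertices of an undirected graph. Its formulas, each of which has at most two free variables, are built from the atoms $x=y$ and $x\sim y$ (adjacency) by conjunction, negation, and the $k$-walk quantifier $$\exists^{j}(z_2,\dots,z_k).\ \bigwedge_{i=1}^{k}\varphi_i(z_i,z_{i+1}),$$ where $j\in\mathbb N$, the variables $z_1,\dots,z_{k+1}$ are pairwise distinct, and each $\varphi_i$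 is a formula whose free variables are among $z_i,z_{i+1}$; it holds if at least $j$ distinct tuples of values for $(z_2,\dots,z_k)$ satisfy the conjunction. The quantifier depth of a formula is the nesting depth of walk quantifiers. Walk counting logic is the union of these logics over all $k\in\mathbb N$. A sentence (a formula without free variables) distinguishes two graphs if its truth values on them differ. **Statement.** Every walk counting logic sentence distinguishing $X(G_n^2)$ from $\tilde X(G_n^2)$ has quantifier depth $\Omega(n)$. That is, there is a constant $c>0$ such that for all $n\ge 3$, every choice of the twisted edge, all $k\in\mathbb N$ and every sentence $\varphi$ of the $k$-walk counting logic that distinguishes $X(G_n^2)$ from $\tilde X(G_n^2)$, the quantifier depth of $\varphi$ is at least $c\,n$. -/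

import Mathlib

/-!
# Walk counting logic and CFI graphs over ladder graphs
-/

/-- Formulas in the syntax of walk counting logic over a set of `k + 1` variables
`Fin (k + 1)`, before the condition on free variables (`WalkFormula.IsWF`) is imposed.
`walk j z φ` is the `k`-walk quantifier
`∃^j (z 1, …, z (k-1)). ⋀ i, φ i (z i, z (i+1))`.
The variables `z 0, …, z k` are pairwise distinct, so they list all `k + 1` variables and `z` is a
permutation. -/
inductive WalkFormula (k : ℕ) : Type
  | eq (x y : Fin (k + 1)) : WalkFormula k
  | adj (x y : Fin (k + 1)) : WalkFormula k
  | and (φ ψ : WalkFormula k) : WalkFormula k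
  | neg (φ : WalkFormula k) : WalkFormula k
  | walk (j : ℕ) (z : Equiv.Perm (Fin (k + 1))) (φ : Fin k → WalkFormula k) : WalkFormula k

namespace WalkFormula

variable {k : ℕ}

/-- The free variables of a formula. The walk quantifier binds every variable
except its two end variables `z 0` and `z k`. -/
def freeVars : WalkFormula k → Set (Fin (k + 1))
  | eq x y => {x, y}
  | adj x y => {x, y}
  | and φ ψ => φ.freeVars ∪ ψ.freeVars
  | neg φ => φ.freeVars
  | walk _ z φ => (⋃ i, (φ i).freeVars) ∩ {z 0, z (Fin.last k)}

/-- Membership in the `k`-walk counting logic: every subformula has at most two free variables, and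
the `i`-th formula below a walk quantifier has its free variables among `z i`, `z (i+1)`. -/
def IsWF : WalkFormula k → Prop
  | eq _ _ => True
  | adj _ _ => True
  | and φ ψ => φ.IsWF ∧ ψ.IsWF ∧ ∃ x y, φ.freeVars ∪ ψ.freeVars ⊆ {x, y}
  | neg φ => φ.IsWF
  | walk _ z φ => ∀ i : Fin k, (φ i).IsWF ∧ (φ i).freeVars ⊆ {z i.castSucc, z i.succ}

/-- A sentence of the `k`-walk counting logic. -/
def IsSentence (φ : WalkFormula k) : Prop :=
  φ.IsWF ∧ φ.freeVars = ∅

/-- Nesting depth of walk quantifiers. -/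
def quantifierDepth : WalkFormula k → ℕ
  | eq _ _ => 0
  | adj _ _ => 0
  | and φ ψ => max φ.quantifierDepth ψ.quantifierDepth
  | neg φ => φ.quantifierDepth
  | walk _ _ φ => (Finset.univ.sup fun i => (φ i).quantifierDepth) + 1

/-- Truth of a formula in the graph `G` under the assignment `s`. For the walk quantifier, the
tuples of values of `z 1, …, z (k-1)` are counted as the walks `w` (the value of `z i` is `w i`)
whose end vertices are the values `s (z 0)` and `s (z k)`. -/
def Realize {V : Type*} (G : SimpleGraph V) : WalkFormula k → (Fin (k + 1) → V) → Prop
  | eq x y, s => s x = s y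
  | adj x y, s => G.Adj (s x) (s y)
  | and φ ψ, s => φ.Realize G s ∧ ψ.Realize G s
  | neg φ, s => ¬ φ.Realize G s
  | walk j z φ, s =>
      (j : ℕ∞) ≤ Set.encard {w : Fin (k + 1) → V |
        w 0 = s (z 0) ∧ w (Fin.last k) = s (z (Fin.last k)) ∧
          ∀ i : Fin k, (φ i).Realize G fun x => w (z.symm x)}

/-- Truth of a sentence in a graph (the truth value of a sentence does not depend on the
assignment). -/
def Models {V : Type*} (G : SimpleGraph V) (φ : WalkFormula k) : Prop :=
  ∀ s : Fin (k + 1) → V, φ.Realize G s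

/-- `φ` is a sentence with different truth values in `G` and `H`. -/
def Distinguishes {V W : Type*} (φ : WalkFormula k) (G : SimpleGraph V) (H : SimpleGraph W) :
    Prop :=
  φ.IsSentence ∧ ¬ (φ.Models G ↔ φ.Models H)

end WalkFormula

/-- The vertices of the CFI graph over the base graph `G`: a base vertex `v` (the origin) together
with a 0-1-tuple, indexed by the base edges incident to `v`, having an even number of ones. -/
@[ext]
structure CFIVertex {V : Type*} (G : SimpleGraph V) where
  origin : V
  bits : G.incidenceSet origin → Bool
  even_ones : Even (Set.ncard {e | bits e = true})

/-- The CFI graph `X(G)`: two vertices are adjacent if their origins `u`, `v` are adjacent in the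
base graph and their tuples agree in the entry of the base edge `{u, v}`. -/
def cfiGraph {V : Type*} (G : SimpleGraph V) : SimpleGraph (CFIVertex G) where
  Adj x y := ∃ h : G.Adj x.origin y.origin,
    x.bits ⟨s(x.origin, y.origin), (G.mk'_mem_incidenceSet_left_iff).2 h⟩ =
      y.bits ⟨s(x.origin, y.origin), (G.mk'_mem_incidenceSet_right_iff).2 h⟩
  symm := by
    constructor
    rintro ⟨u, a, ha⟩ ⟨v, b, hb⟩ ⟨h, hab⟩
    refine ⟨h.symm, ?_⟩
    simp only [Sym2.eq_swap (a := v) (b := u)]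
    exact hab.symm
  loopless := ⟨fun x h => G.loopless.irrefl _ h.1⟩

/-- The twisted CFI graph `X̃(G)`, obtained from `X(G)` by twisting the base edge `e = {u, v}`:
edges and nonedges between the gadget of `u` and the gadget of `v` are exchanged. -/
def twistedCFIGraph {V : Type*} (G : SimpleGraph V) (e : G.edgeSet) :
    SimpleGraph (CFIVertex G) where
  Adj x y := (s(x.origin, y.origin) = (e : Sym2 V) ∧ ¬ (cfiGraph G).Adj x y) ∨
    (s(x.origin, y.origin) ≠ (e : Sym2 V) ∧ (cfiGraph G).Adj x y)
  symm := by
    constructor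
    intro x y h
    rwa [Sym2.eq_swap, (cfiGraph G).adj_comm] at h
  loopless := by
    constructor
    rintro x (⟨h, -⟩ | ⟨-, h⟩)
    · exact G.loopless.irrefl x.origin ((G.mem_edgeSet).1 (h ▸ e.2))
    · exact (cfiGraph G).loopless.irrefl x h

/-- The `2 × n` grid with one additional vertex `none` attached to the corner `(0, 0)`. -/
def gridWithTail (n : ℕ) : SimpleGraph (Option (Fin 2 × Fin n)) where
  Adj
    | some p, some q => (SimpleGraph.pathGraph 2 □ SimpleGraph.pathGraph n).Adj p q
    | none, some q => (q.1 : ℕ) = 0 ∧ (q.2 : ℕ) = 0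
    | some p, none => (p.1 : ℕ) = 0 ∧ (p.2 : ℕ) = 0
    | none, none => False
  symm := by
    constructor
    rintro (_ | p) (_ | q) h
    · exact h
    · exact h
    · exact h
    · exact SimpleGraph.Adj.symm h
  loopless := by
    constructor
    rintro (_ | p) h
    · exact h
    · exact SimpleGraph.irrefl _ h

namespace WalkFormula

/-- The truth value of a well-formed formula depends only on the values of its free variables. -/
theorem realize_congr {k : ℕ} {V : Type*} (G : SimpleGraph V) :
    ∀ (φ : WalkFormula k), φ.IsWF → ∀ s s' : Fin (k + 1) → V,
      (∀ x ∈ φ.freeVars, s x = s' x) → (φ.Realize G s ↔ φ.Realize G s') := by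
  intro φ
  induction φ with
  | eq x y =>
    intro _ s s' h
    simp only [Realize, h x (by simp [freeVars]), h y (by simp [freeVars])]
  | adj x y =>
    intro _ s s' h
    simp only [Realize, h x (by simp [freeVars]), h y (by simp [freeVars])]
  | and φ ψ ihφ ihψ =>
    intro hwf s s' h
    exact and_congr (ihφ hwf.1 s s' fun x hx => h x (Or.inl hx))
      (ihψ hwf.2.1 s s' fun x hx => h x (Or.inr hx))
  | neg φ ih =>
    intro hwf s s' h
    exact not_congr (ih hwf s s' h)
  | walk j z φ ih =>
    intro hwf
    have key : ∀ s s' : Fin (k + 1) → V,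
        (∀ x ∈ (walk j z φ).freeVars, s x = s' x) →
        (walk j z φ).Realize G s → (walk j z φ).Realize G s' := by
      intro s s' h hs
      let f : (Fin (k + 1) → V) → Fin (k + 1) → V := fun w i =>
        if i = 0 then s' (z 0) else if i = Fin.last k then s' (z (Fin.last k)) else w i
      refine le_trans hs ?_
      refine Set.encard_le_encard_of_injOn (f := f) ?_ ?_
      · rintro w ⟨h0, hk, hw⟩
        refine ⟨by simp [f], ?_, fun i => ?_⟩
        · by_cases hk0 : Fin.last k = 0
          · simp [f, hk0]
          · simp [f, hk0]
        · refine (ih i (hwf i).1 _ _ fun x hx => ?_).1 (hw i)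
          by_cases hx0 : z.symm x = 0
          · have hxz : x = z 0 := by rw [← hx0]; simp
            have := h x ⟨Set.mem_iUnion.2 ⟨i, hx⟩, by simp [hxz]⟩
            simp only [f, hx0, if_true, h0]
            rw [← hxz, this]
          · by_cases hxk : z.symm x = Fin.last k
            · have hxz : x = z (Fin.last k) := by rw [← hxk]; simp
              have := h x ⟨Set.mem_iUnion.2 ⟨i, hx⟩, by simp [hxz]⟩
              have hk0 : Fin.last k ≠ 0 := by rwa [hxk] at hx0
              simp only [f, hxk, if_true, hk0, if_false, hk]
              rw [← hxz, this]
            · simp [f, hx0, hxk]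
      · rintro w ⟨h0, hk, -⟩ w' ⟨h0', hk', -⟩ hww
        funext i
        have := congrFun hww i
        by_cases hi0 : i = 0
        · rw [hi0, h0, h0']
        · by_cases hik : i = Fin.last k
          · rw [hik, hk, hk']
          · simpa [f, hi0, hik] using this
    intro s s' h
    exact ⟨key s s' h, key s' s fun x hx => (h x hx).symm⟩

end WalkFormula

theorem Set.even_ncard_xor {α : Type*} [Finite α] {a b : α → Bool}
    (ha : Even (Set.ncard {e | a e = true})) (hb : Even (Set.ncard {e | b e = true})) :
    Even (Set.ncard {e | (a e ^^ b e) = true}) := by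
  set A := {e | a e = true}
  set B := {e | b e = true}
  have hAB : {e | (a e ^^ b e) = true} = (A \ B) ∪ (B \ A) := by
    ext e
    cases hae : a e <;> cases hbe : b e <;> simp [A, B, hae, hbe]
  rw [hAB, Set.ncard_union_eq (Set.disjoint_left.2 fun e h h' => h.2 h'.1)]
  have h1 := Set.ncard_inter_add_ncard_sdiff_eq_ncard A B
  have h2 := Set.ncard_inter_add_ncard_sdiff_eq_ncard B A
  rw [Set.inter_comm] at h2
  grind

/-- A family of bit flips, one for each gadget: the entry of the edge `e` in the gadget of `v` is
flipped if `toFun v e` is true. The number of entries flipped in each gadget is even. -/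
@[ext]
structure GadgetFlip {V : Type*} (G : SimpleGraph V) where
  toFun : V → Sym2 V → Bool
  even_flips : ∀ v, Even (Set.ncard {e : G.incidenceSet v | toFun v e = true})

namespace GadgetFlip

variable {V : Type*} {G : SimpleGraph V}

/-- Composition of flips. -/
def comp [Finite V] (F F' : GadgetFlip G) : GadgetFlip G where
  toFun v e := F.toFun v e ^^ F'.toFun v e
  even_flips v := Set.even_ncard_xor (F.even_flips v) (F'.even_flips v)

@[simp]
theorem comp_toFun [Finite V] (F F' : GadgetFlip G) (v : V) (e : Sym2 V) :
    (F.comp F').toFun v e = (F.toFun v e ^^ F'.toFun v e) := rfl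

/-- The action of a flip on the vertices of the CFI graph. -/
def act [Finite V] (F : GadgetFlip G) (x : CFIVertex G) : CFIVertex G where
  origin := x.origin
  bits e := x.bits e ^^ F.toFun x.origin e
  even_ones := Set.even_ncard_xor x.even_ones (F.even_flips x.origin)

@[simp]
theorem act_origin [Finite V] (F : GadgetFlip G) (x : CFIVertex G) :
    (F.act x).origin = x.origin := rfl

theorem act_congr [Finite V] {F F' : GadgetFlip G} {x : CFIVertex G}
    (h : F.toFun x.origin = F'.toFun x.origin) : F.act x = F'.act x := by
  simp only [act, h]

@[simp]
theorem act_act [Finite V] (F : GadgetFlip G) (x : CFIVertex G) : F.act (F.act x) = x := by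
  rcases x with ⟨o, b, hb⟩
  simp [act]

theorem act_bijective [Finite V] (F : GadgetFlip G) : Function.Bijective F.act :=
  Function.Involutive.bijective F.act_act

open Classical in
/-- The flip `F` moves a twist from the edge `e` to the edge `e'`: it flips both entries
belonging to an edge or none of them, except at `e` and at `e'`. -/
def Moves (F : GadgetFlip G) (e e' : Sym2 V) : Prop :=
  ∀ u v, G.Adj u v → (F.toFun u s(u, v) ^^ F.toFun v s(u, v)) =
    (decide (s(u, v) = e) ^^ decide (s(u, v) = e'))

theorem Moves.comp [Finite V] {F F' : GadgetFlip G} {e e' e'' : Sym2 V} (h : F.Moves e e')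
    (h' : F'.Moves e' e'') : (F.comp F').Moves e e'' := by
  intro u v huv
  have h1 := h u v huv
  have h2 := h' u v huv
  have xor_trans : ∀ a b c d p q r : Bool, (a ^^ b) = (p ^^ q) → (c ^^ d) = (q ^^ r) →
    ((a ^^ c) ^^ (b ^^ d)) = (p ^^ r) := by decide
  exact xor_trans _ _ _ _ _ _ _ h1 h2

theorem Moves.symm {F : GadgetFlip G} {e e' : Sym2 V} (h : F.Moves e e') : F.Moves e' e := by
  intro u v huv
  rw [h u v huv, Bool.xor_comm]

/-- The flip with no effect. -/
def id (G : SimpleGraph V) : GadgetFlip G where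
  toFun _ _ := false
  even_flips v := by simp

theorem moves_id (e : Sym2 V) : (id G).Moves e e := by
  intro u v huv
  simp [id]

open Classical in
/-- The flip of the entries of two edges at a common end `p`. -/
noncomputable def turn (p : V) {e e' : Sym2 V} (he : e ∈ G.incidenceSet p) (he' : e' ∈ G.incidenceSet p)
    (hne : e ≠ e') : GadgetFlip G where
  toFun v f := decide (v = p ∧ (f = e ∨ f = e'))
  even_flips v := by
    by_cases hv : v = p
    · subst hv
      have : {f : G.incidenceSet v | decide (v = v ∧ ((f : Sym2 V) = e ∨ (f : Sym2 V) = e')) = true}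
          = {⟨e, he⟩, ⟨e', he'⟩} := by
        ext f
        simp [Subtype.ext_iff]
      rw [this, Set.ncard_pair (by simpa [Subtype.ext_iff] using hne)]
      exact even_two
    · simp [hv]

theorem turn_of_ne {p v : V} {e e' : Sym2 V} (he : e ∈ G.incidenceSet p)
    (he' : e' ∈ G.incidenceSet p) (hne : e ≠ e') (hv : v ≠ p) (f : Sym2 V) :
    (turn p he he' hne).toFun v f = false := by
  simp [turn, hv]

theorem moves_turn {p : V} {e e' : Sym2 V} (he : e ∈ G.incidenceSet p)
    (he' : e' ∈ G.incidenceSet p) (hne : e ≠ e') : (turn p he he' hne).Moves e e' := by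
  intro u v huv
  have hp : p ∈ e := he.2
  have hp' : p ∈ e' := he'.2
  have hne' := huv.ne
  by_cases h : s(u, v) = e
  · subst h
    rcases Sym2.mem_iff.1 hp with rfl | rfl <;> simp [turn, hne, hne', hne'.symm]
  · by_cases h' : s(u, v) = e'
    · subst h'
      rcases Sym2.mem_iff.1 hp' with rfl | rfl <;> simp [turn, hne.symm, hne', hne'.symm]
    · simp [turn, h, h']

/-- The twist can be moved from `e` to `e'` by a flip that is trivial outside of `S`. -/
def CanMove (G : SimpleGraph V) (S : Set V) (e e' : Sym2 V) : Prop :=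
  ∃ F : GadgetFlip G, F.Moves e e' ∧ ∀ v ∉ S, ∀ f, F.toFun v f = false

theorem CanMove.refl (S : Set V) (e : Sym2 V) : CanMove G S e e :=
  ⟨id G, moves_id e, fun _ _ _ => rfl⟩

theorem CanMove.symm {S : Set V} {e e' : Sym2 V} (h : CanMove G S e e') : CanMove G S e' e := by
  obtain ⟨F, hF, h⟩ := h
  exact ⟨F, hF.symm, h⟩

theorem CanMove.trans [Finite V] {S : Set V} {e e' e'' : Sym2 V} (h : CanMove G S e e')
    (h' : CanMove G S e' e'') : CanMove G S e e'' := by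
  obtain ⟨F, hF, h⟩ := h
  obtain ⟨F', hF', h'⟩ := h'
  exact ⟨F.comp F', hF.comp hF', fun v hv f => by simp [h v hv, h' v hv]⟩

theorem canMove_of_mem {S : Set V} {p : V} (hpS : p ∈ S) {e e' : Sym2 V}
    (he : e ∈ G.incidenceSet p) (he' : e' ∈ G.incidenceSet p) : CanMove G S e e' := by
  by_cases hne : e = e'
  · exact hne ▸ CanMove.refl S e
  · exact ⟨turn p he he' hne, moves_turn he he' hne,
      fun v hv f => turn_of_ne he he' hne (fun h => hv (by rwa [h])) f⟩

/-- A flip that moves the twist to `e'` preserves adjacency, except between the gadgets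
connected by `e'`. -/
theorem Moves.adj_iff [Finite V] {F : GadgetFlip G} {e : G.edgeSet} {e' : Sym2 V}
    (h : F.Moves e e') {x y : CFIVertex G} (hxy : s(x.origin, y.origin) ≠ e') :
    (twistedCFIGraph G e).Adj (F.act x) (F.act y) ↔ (cfiGraph G).Adj x y := by
  by_cases hadj : G.Adj x.origin y.origin
  · have h1 := h _ _ hadj
    simp only [hxy, decide_false, Bool.xor_false] at h1
    have hx : (cfiGraph G).Adj x y ↔
      x.bits ⟨s(x.origin, y.origin), (G.mk'_mem_incidenceSet_left_iff).2 hadj⟩ =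
        y.bits ⟨s(x.origin, y.origin), (G.mk'_mem_incidenceSet_right_iff).2 hadj⟩ :=
      ⟨fun h => h.2, fun h => ⟨hadj, h⟩⟩
    have hF : (cfiGraph G).Adj (F.act x) (F.act y) ↔
      (x.bits ⟨s(x.origin, y.origin), (G.mk'_mem_incidenceSet_left_iff).2 hadj⟩ ^^
          F.toFun x.origin s(x.origin, y.origin)) =
        (y.bits ⟨s(x.origin, y.origin), (G.mk'_mem_incidenceSet_right_iff).2 hadj⟩ ^^
          F.toFun y.origin s(x.origin, y.origin)) :=
      ⟨fun h => h.2, fun h => ⟨hadj, h⟩⟩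
    generalize x.bits _ = a at hx hF
    generalize y.bits _ = b at hx hF
    generalize F.toFun x.origin _ = f at h1 hF
    generalize F.toFun y.origin _ = g at h1 hF
    by_cases he : s(x.origin, y.origin) = (e : Sym2 V)
    · simp only [twistedCFIGraph, hF, hx, act_origin, he, decide_true] at h1 ⊢
      revert a b f g
      simp
    · simp only [twistedCFIGraph, hF, hx, act_origin, he, decide_false] at h1 ⊢
      revert a b f g
      simp [he]
  · have hx : ¬ (cfiGraph G).Adj x y := fun h => hadj h.1
    have hF : ¬ (cfiGraph G).Adj (F.act x) (F.act y) := fun h => hadj h.1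
    have he : s(x.origin, y.origin) ≠ (e : Sym2 V) := fun he =>
      hadj ((G.mem_edgeSet).1 (he ▸ e.2))
    simp [twistedCFIGraph, hx, hF, he]

end GadgetFlip
namespace GadgetFlip

variable {V : Type*} {G : SimpleGraph V} [Finite V]

open Classical in
/-- Along every walk `o` of base vertices from `u` to `v`, the flip `F`, which moves the twist to
`e₀ = {p, p'}`, can be modified such that any two consecutive vertices see a flip moving
the twist to an edge (`e₀` or `e₁`) that is not the one between them. -/
theorem Moves.exists_reroute {F P P' : GadgetFlip G} {e e₀ e₁ : Sym2 V} (hF : F.Moves e e₀)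
    (hP : P.Moves e₀ e₁) (hP' : P'.Moves e₀ e₁) (hne : e₀ ≠ e₁) {p p' : V} (he₀ : e₀ = s(p, p'))
    (hp : ∀ f, P.toFun p f = false) (hp' : ∀ f, P'.toFun p' f = false) {u v : V}
    (huv : P.toFun u = P'.toFun u ∨ P.toFun v = P'.toFun v) {k : ℕ} (o : Fin (k + 1) → V) :
    ∃ Φ : Fin (k + 1) → GadgetFlip G,
      (o 0 = u → (Φ 0).toFun u = F.toFun u) ∧
      (o (Fin.last k) = v → (Φ (Fin.last k)).toFun v = F.toFun v) ∧
      ∀ i : Fin k, ∃ (F' : GadgetFlip G) (e' : Sym2 V), (e' = e₀ ∨ e' = e₁) ∧ F'.Moves e e' ∧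
        s(o i.castSucc, o i.succ) ≠ e' ∧
        F'.toFun (o i.castSucc) = (Φ i.castSucc).toFun (o i.castSucc) ∧
        F'.toFun (o i.succ) = (Φ i.succ).toFun (o i.succ) := by
  let C : GadgetFlip G := P.comp P'
  have hC : C.Moves e₀ e₀ := hP.comp hP'.symm
  let B : Bool → GadgetFlip G := fun b => if b then F.comp C else F
  have hB : ∀ b, (B b).Moves e e₀ := by
    intro b
    cases b
    · exact hF
    · exact hF.comp hC
  have hBF : ∀ b w, P.toFun w = P'.toFun w → (B b).toFun w = F.toFun w := by
    intro b w hw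
    cases b
    · rfl
    · funext f
      simp [B, C, hw]
  -- the number of times `o` has crossed `e₀`, modulo two
  let c : Fin (k + 1) → Bool := fun i => Fin.induction (motive := fun _ => Bool) false
    (fun j b => b ^^ decide (s(o j.castSucc, o j.succ) = e₀)) i
  have hc0 : c 0 = false := rfl
  have hcs : ∀ j : Fin k, c j.succ = (c j.castSucc ^^ decide (s(o j.castSucc, o j.succ) = e₀)) :=
    fun j => Fin.induction_succ ..
  obtain ⟨b, hb, hb'⟩ : ∃ b : Bool, (o 0 = u → (B (b ^^ c 0)).toFun u = F.toFun u) ∧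
      (o (Fin.last k) = v → (B (b ^^ c (Fin.last k))).toFun v = F.toFun v) := by
    rcases huv with h | h
    · exact ⟨c (Fin.last k), fun _ => hBF _ _ h, fun _ => by simp [B]⟩
    · exact ⟨false, fun _ => by simp [hc0, B], fun _ => hBF _ _ h⟩
  refine ⟨fun i => B (b ^^ c i), hb, hb', fun i => ?_⟩
  have hbc : (b ^^ c i.succ) =
      ((b ^^ c i.castSucc) ^^ decide (s(o i.castSucc, o i.succ) = e₀)) := by
    rw [hcs, Bool.xor_assoc]
  simp only [hbc]
  generalize (b ^^ c i.castSucc) = d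
  by_cases h : s(o i.castSucc, o i.succ) = e₀
  · -- when crossing `e₀`, move the twist to `e₁` by the flip that is trivial at the start
    have cross : ∀ Q Q' : GadgetFlip G, Q.Moves e₀ e₁ → (∀ f, Q.toFun (o i.castSucc) f = false) →
        (∀ f, Q'.toFun (o i.succ) f = false) →
        (∀ w f, C.toFun w f = (Q.toFun w f ^^ Q'.toFun w f)) →
        ((B d).comp Q).Moves e e₁ ∧
          ((B d).comp Q).toFun (o i.castSucc) = (B d).toFun (o i.castSucc) ∧
          ((B d).comp Q).toFun (o i.succ) = (B (d ^^ true)).toFun (o i.succ) := by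
      intro Q Q' hQ h1 h2 hQC
      refine ⟨(hB d).comp hQ, ?_, ?_⟩
      · funext f
        simp [h1]
      · funext f
        cases d
        · simp [B, hQC, h2]
        · simp [B, hQC, h2]
    simp only [h, decide_true]
    rw [he₀] at h
    rcases Sym2.eq_iff.1 h with ⟨h1, h2⟩ | ⟨h1, h2⟩
    · obtain ⟨m, a1, a2⟩ := cross P P' hP (by simpa [h1] using hp) (by simpa [h2] using hp')
        (fun _ _ => rfl)
      exact ⟨_, e₁, Or.inr rfl, m, hne, a1, a2⟩
    · obtain ⟨m, a1, a2⟩ := cross P' P hP' (by simpa [h1] using hp') (by simpa [h2] using hp)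
        (fun _ _ => Bool.xor_comm _ _)
      exact ⟨_, e₁, Or.inr rfl, m, hne, a1, a2⟩
  · exact ⟨B d, e₀, Or.inl rfl, hB d, h, rfl, by simp [h]⟩

end GadgetFlip

namespace WalkFormula

open GadgetFlip

/-- A walk quantifier is preserved by a flip `F` if, along every walk of base vertices, `F` can be
modified such that the quantified formulas are preserved. -/
theorem realize_walk_iff {V : Type*} [Finite V] {G : SimpleGraph V} {e : G.edgeSet} {k : ℕ}
    {j : ℕ} {z : Equiv.Perm (Fin (k + 1))} {φ : Fin k → WalkFormula k} {F : GadgetFlip G}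
    {s : Fin (k + 1) → CFIVertex G}
    (h : ∀ o : Fin (k + 1) → V, ∃ Φ : Fin (k + 1) → GadgetFlip G,
      (o 0 = (s (z 0)).origin →
        (Φ 0).toFun (s (z 0)).origin = F.toFun (s (z 0)).origin) ∧
      (o (Fin.last k) = (s (z (Fin.last k))).origin →
        (Φ (Fin.last k)).toFun (s (z (Fin.last k))).origin =
          F.toFun (s (z (Fin.last k))).origin) ∧
      ∀ i : Fin k, ∀ w : Fin (k + 1) → CFIVertex G, (∀ l, (w l).origin = o l) →
        (((φ i).Realize (cfiGraph G) fun x => w (z.symm x)) ↔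
          (φ i).Realize (twistedCFIGraph G e) fun x => (Φ (z.symm x)).act (w (z.symm x)))) :
    (walk j z φ).Realize (cfiGraph G) s ↔
      (walk j z φ).Realize (twistedCFIGraph G e) fun x => F.act (s x) := by
  choose Φ h0 hk hφ using h
  let Ψ : (Fin (k + 1) → CFIVertex G) → Fin (k + 1) → CFIVertex G :=
    fun w i => (Φ (fun l => (w l).origin) i).act (w i)
  have hΨ : Function.Involutive Ψ := by
    intro w
    funext i
    simp [Ψ]
  have key : ∀ (w : Fin (k + 1) → CFIVertex G) (l : Fin (k + 1)) (x : CFIVertex G),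
      ((w l).origin = x.origin →
        (Φ (fun l => (w l).origin) l).toFun x.origin = F.toFun x.origin) →
      (w l = x ↔ Ψ w l = F.act x) := by
    intro w l x hx
    constructor
    · intro hw
      simp only [Ψ, hw]
      exact act_congr (hx (by rw [hw]))
    · intro hw
      have ho : (w l).origin = x.origin := by
        have : (Ψ w l).origin = (F.act x).origin := by rw [hw]
        exact this
      have : Ψ w l = F.act (w l) := act_congr (by rw [ho]; exact hx ho)
      exact F.act_bijective.injective (this.symm.trans hw)
  have hset : {w : Fin (k + 1) → CFIVertex G | w 0 = s (z 0) ∧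
        w (Fin.last k) = s (z (Fin.last k)) ∧
        ∀ i : Fin k, (φ i).Realize (cfiGraph G) fun x => w (z.symm x)} =
      Ψ ⁻¹' {w : Fin (k + 1) → CFIVertex G | w 0 = F.act (s (z 0)) ∧
        w (Fin.last k) = F.act (s (z (Fin.last k))) ∧
        ∀ i : Fin k, (φ i).Realize (twistedCFIGraph G e) fun x => w (z.symm x)} := by
    ext w
    refine and_congr (key w _ _ (h0 fun l => (w l).origin))
      (and_congr (key w _ _ (hk fun l => (w l).origin)) ?_)
    exact forall_congr' fun i => hφ (fun l => (w l).origin) i w fun _ => rfl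
  simp only [Realize]
  rw [hset, Set.encard_preimage_of_bijective hΨ.bijective]

end WalkFormula
open GadgetFlip

/-- The grid vertex in row `r` and column `i`. -/
def gridPoint (n : ℕ) (r : Fin 2) (i : ℕ) : Option (Fin 2 × Fin n) :=
  if h : i < n then some (r, ⟨i, h⟩) else none

/-- The horizontal edge in row `r` between the columns `i` and `i + 1`. -/
def horizontalEdge (n : ℕ) (r : Fin 2) (i : ℕ) : Sym2 (Option (Fin 2 × Fin n)) :=
  s(gridPoint n r i, gridPoint n r (i + 1))

theorem gridPoint_inj {n i i' : ℕ} {r r' : Fin 2} (hi : i < n) (hi' : i' < n) :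
    gridPoint n r i = gridPoint n r' i' ↔ r = r' ∧ i = i' := by
  simp [gridPoint, hi, hi']

theorem gridWithTail_adj_horizontal {n i : ℕ} (r : Fin 2) (hi : i + 1 < n) :
    (gridWithTail n).Adj (gridPoint n r i) (gridPoint n r (i + 1)) := by
  have hi' : i < n := by omega
  simp [gridPoint, hi, hi', gridWithTail, SimpleGraph.pathGraph_adj]

theorem gridWithTail_adj_vertical {n i : ℕ} {r r' : Fin 2} (hr : r ≠ r') (hi : i < n) :
    (gridWithTail n).Adj (gridPoint n r i) (gridPoint n r' i) := by
  have : (r : ℕ) + 1 = r' ∨ (r' : ℕ) + 1 = r := by omega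
  simp [gridPoint, hi, gridWithTail, SimpleGraph.pathGraph_adj, this]

theorem diag_ne_horizontalEdge {n i : ℕ} {r : Fin 2} (hi : i + 1 < n)
    (u : Option (Fin 2 × Fin n)) : s(u, u) ≠ horizontalEdge n r i := by
  intro hu
  have := gridWithTail_adj_horizontal r hi
  rw [← SimpleGraph.mem_edgeSet, ← horizontalEdge, ← hu] at this
  exact (gridWithTail n).loopless.irrefl _ this

theorem horizontalEdge_mem_left {n i : ℕ} (r : Fin 2) (hi : i + 1 < n) :
    horizontalEdge n r i ∈ (gridWithTail n).incidenceSet (gridPoint n r i) :=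
  (SimpleGraph.mk'_mem_incidenceSet_left_iff _).2 (gridWithTail_adj_horizontal r hi)

theorem horizontalEdge_mem_right {n i : ℕ} (r : Fin 2) (hi : i + 1 < n) :
    horizontalEdge n r i ∈ (gridWithTail n).incidenceSet (gridPoint n r (i + 1)) :=
  (SimpleGraph.mk'_mem_incidenceSet_right_iff _).2 (gridWithTail_adj_horizontal r hi)

/-- The twist can be moved along a square of the grid through the column `c`. -/
theorem canMove_horizontalEdge_of_col {n i c : ℕ} {r r' : Fin 2} (hr : r ≠ r') (hi : i + 1 < n)
    (hc : c = i ∨ c = i + 1) :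
    CanMove (gridWithTail n) {gridPoint n r c, gridPoint n r' c}
      (horizontalEdge n r i) (horizontalEdge n r' i) := by
  have hcn : c < n := by omega
  have hmem : ∀ r : Fin 2, horizontalEdge n r i ∈
      (gridWithTail n).incidenceSet (gridPoint n r c) := by
    intro r
    rcases hc with rfl | rfl
    · exact horizontalEdge_mem_left r hi
    · exact horizontalEdge_mem_right r hi
  have hv := gridWithTail_adj_vertical hr hcn
  exact (canMove_of_mem (by simp) (hmem r)
      ((SimpleGraph.mk'_mem_incidenceSet_left_iff _).2 hv)).trans
    (canMove_of_mem (by simp) ((SimpleGraph.mk'_mem_incidenceSet_right_iff _).2 hv) (hmem r'))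

theorem canMove_horizontalEdge_succ {n i : ℕ} {r : Fin 2} (hi : i + 2 < n)
    {S : Set (Option (Fin 2 × Fin n))} (hS : gridPoint n r (i + 1) ∈ S) :
    CanMove (gridWithTail n) S (horizontalEdge n r i) (horizontalEdge n r (i + 1)) :=
  canMove_of_mem hS (horizontalEdge_mem_right r (by omega)) (horizontalEdge_mem_left r hi)

/-- Any edge can be moved to any horizontal edge of the grid. -/
theorem canMove_univ_horizontalEdge {n i : ℕ} {r : Fin 2} (hi : i + 1 < n)
    (e : (gridWithTail n).edgeSet) :
    CanMove (gridWithTail n) Set.univ e (horizontalEdge n r i) := by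
  have hhor : ∀ j, j + 1 < n → CanMove (gridWithTail n) Set.univ
      (horizontalEdge n 0 0) (horizontalEdge n 0 j) := by
    intro j hj
    induction j with
    | zero => exact CanMove.refl _ _
    | succ j ih => exact (ih (by omega)).trans (canMove_horizontalEdge_succ hj (Set.mem_univ _))
  have hall : ∀ (r : Fin 2) (j : ℕ), j + 1 < n → CanMove (gridWithTail n) Set.univ
      (horizontalEdge n 0 0) (horizontalEdge n r j) := by
    intro r j hj
    by_cases hr : r = 0
    · exact hr ▸ hhor j hj
    · obtain ⟨P, hP, -⟩ := canMove_horizontalEdge_of_col (Ne.symm hr) hj (Or.inl rfl)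
      exact (hhor j hj).trans ⟨P, hP, fun _ h => absurd (Set.mem_univ _) h⟩
  have hmem : ∀ p : Fin 2 × Fin n, ∃ r j, j + 1 < n ∧
      horizontalEdge n r j ∈ (gridWithTail n).incidenceSet (some p) := by
    rintro ⟨r, j, hj⟩
    by_cases hjn : j + 1 < n
    · refine ⟨r, j, hjn, ?_⟩
      have := horizontalEdge_mem_left r hjn
      simpa [gridPoint, hj] using this
    · have hj1 : j - 1 + 1 = j := by omega
      refine ⟨r, j - 1, by omega, ?_⟩
      have := horizontalEdge_mem_right (n := n) (i := j - 1) r (by omega)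
      simpa [hj1, gridPoint, hj] using this
  have hsome : ∃ p : Fin 2 × Fin n, some p ∈ (e : Sym2 (Option (Fin 2 × Fin n))) := by
    obtain ⟨e, he⟩ := e
    induction e with
    | h x y =>
      rcases x with _ | p
      · rcases y with _ | q
        · exact absurd he ((gridWithTail n).loopless.irrefl none)
        · exact ⟨q, by simp⟩
      · exact ⟨p, by simp⟩
  obtain ⟨p, hp⟩ := hsome
  obtain ⟨r', j, hj, hrj⟩ := hmem p
  exact ((canMove_of_mem (Set.mem_univ _) ⟨e.2, hp⟩ hrj).trans (hall r' j hj).symm).trans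
    (hall r i hi)

/-- `u` is not a corner of the square between the columns `i` and `i + 1`. -/
def OffSquare (n i : ℕ) (u : Option (Fin 2 × Fin n)) : Prop :=
  ∀ r, u ≠ gridPoint n r i ∧ u ≠ gridPoint n r (i + 1)

/-- While `u` and `v` are fixed, a twist at a horizontal edge other than `{u, v}` can be moved by at
most one column to a square not containing both `u` and `v`. -/
theorem exists_canMove_offSquare {n i : ℕ} {r : Fin 2} (hi : 1 ≤ i) (hin : i + 3 ≤ n)
    {u v : Option (Fin 2 × Fin n)} (huv : s(u, v) ≠ horizontalEdge n r i) :
    ∃ i', i ≤ i' + 1 ∧ i' ≤ i + 1 ∧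
      CanMove (gridWithTail n) {w | w ≠ u ∧ w ≠ v} (horizontalEdge n r i) (horizontalEdge n r i') ∧
      (OffSquare n i' u ∨ OffSquare n i' v) := by
  by_cases hoff : OffSquare n i u ∨ OffSquare n i v
  · exact ⟨i, by omega, by omega, CanMove.refl _ _, hoff⟩
  have hcorner : ∀ w, ¬ OffSquare n i w → ∃ q c, (c = i ∨ c = i + 1) ∧ w = gridPoint n q c := by
    intro w hw
    simp only [OffSquare, not_forall, not_and_or, not_not] at hw
    obtain ⟨q, h | h⟩ := hw
    exacts [⟨q, i, Or.inl rfl, h⟩, ⟨q, i + 1, Or.inr rfl, h⟩]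
  rw [not_or] at hoff
  obtain ⟨q, c, hc, rfl⟩ := hcorner u hoff.1
  obtain ⟨q', c', hc', rfl⟩ := hcorner v hoff.2
  have hcn : c < n := by omega
  have hcn' : c' < n := by omega
  have h0 : i < n := by omega
  have h1 : i + 1 < n := by omega
  have hoffSquare : ∀ {i' q c}, i' + 1 < n → c < n → c ≠ i' → c ≠ i' + 1 →
      OffSquare n i' (gridPoint n q c) := by
    intro i' q c hi' hc h h' r
    rw [Ne, gridPoint_inj hc (by omega), Ne, gridPoint_inj hc hi']
    exact ⟨fun h'' => h h''.2, fun h'' => h' h''.2⟩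
  simp only [horizontalEdge, ne_eq, Sym2.eq_iff, gridPoint_inj hcn h0, gridPoint_inj hcn h1,
    gridPoint_inj hcn' h0, gridPoint_inj hcn' h1] at huv
  by_cases hright : ¬ (q = r ∧ c = i + 1) ∧ ¬ (q' = r ∧ c' = i + 1) ∧ (c = i ∨ c' = i)
  · refine ⟨i + 1, by omega, by omega, canMove_horizontalEdge_succ (by omega) ?_, ?_⟩
    · simp only [Set.mem_ofPred_eq, ne_eq, gridPoint_inj h1 hcn, gridPoint_inj h1 hcn']
      grind
    · exact hright.2.2.imp (fun h => hoffSquare (by omega) hcn (by omega) (by omega))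
        fun h => hoffSquare (by omega) hcn' (by omega) (by omega)
  · obtain ⟨i, rfl⟩ : ∃ i', i = i' + 1 := ⟨i - 1, by omega⟩
    have hleft : ¬ (q = r ∧ c = i + 1) ∧ ¬ (q' = r ∧ c' = i + 1) ∧
        (c = i + 1 + 1 ∨ c' = i + 1 + 1) := by
      grind
    refine ⟨i, by omega, by omega, (canMove_horizontalEdge_succ (by omega) ?_).symm, ?_⟩
    · simp only [Set.mem_ofPred_eq, ne_eq, gridPoint_inj h0 hcn, gridPoint_inj h0 hcn']
      grind
    · exact hleft.2.2.imp (fun h => hoffSquare (by omega) hcn (by omega) (by omega))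
        fun h => hoffSquare (by omega) hcn' (by omega) (by omega)

namespace WalkFormula

/-- A flip that moves the twist to a horizontal edge with more than `q` columns on either side
preserves the truth of formulas of quantifier depth at most `q`, unless the free variables are
interpreted in the gadgets of both ends of this edge. -/
theorem realize_flip_iff {n k : ℕ} {e : (gridWithTail n).edgeSet} (φ : WalkFormula k) :
    φ.IsWF → ∀ (q i : ℕ) (r : Fin 2) (F : GadgetFlip (gridWithTail n))
      (s : Fin (k + 1) → CFIVertex (gridWithTail n)),
      φ.quantifierDepth ≤ q → q ≤ i → i + q + 2 ≤ n → F.Moves e (horizontalEdge n r i) →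
      (∀ x ∈ φ.freeVars, ∀ y ∈ φ.freeVars,
        s((s x).origin, (s y).origin) ≠ horizontalEdge n r i) →
      (φ.Realize (cfiGraph (gridWithTail n)) s ↔
        φ.Realize (twistedCFIGraph (gridWithTail n) e) fun x => F.act (s x)) := by
  induction φ with
  | eq x y =>
    intro _ q i r F s _ _ _ _ _
    exact F.act_bijective.injective.eq_iff.symm
  | adj x y =>
    intro _ q i r F s _ _ _ hF hs
    exact (hF.adj_iff (hs x (by simp [freeVars]) y (by simp [freeVars]))).symm
  | and φ ψ ihφ ihψ =>
    intro hwf q i r F s hq hqi hin hF hs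
    have hq' : φ.quantifierDepth ≤ q ∧ ψ.quantifierDepth ≤ q := max_le_iff.1 hq
    exact and_congr
      (ihφ hwf.1 q i r F s hq'.1 hqi hin hF fun x hx y hy => hs x (Or.inl hx) y (Or.inl hy))
      (ihψ hwf.2.1 q i r F s hq'.2 hqi hin hF fun x hx y hy => hs x (Or.inr hx) y (Or.inr hy))
  | neg φ ih =>
    intro hwf q i r F s hq hqi hin hF hs
    exact not_congr (ih hwf q i r F s hq hqi hin hF hs)
  | walk j z φ ih =>
    intro hwf q i r F s hq hqi hin hF hs
    -- the value of an end variable that is not free may be replaced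
    obtain ⟨t, hst, ht⟩ : ∃ t : Fin (k + 1) → CFIVertex (gridWithTail n),
        (∀ x ∈ (walk j z φ).freeVars, s x = t x) ∧
        s((t (z 0)).origin, (t (z (Fin.last k))).origin) ≠ horizontalEdge n r i := by
      by_cases h0 : z 0 ∈ (walk j z φ).freeVars
      · by_cases hk : z (Fin.last k) ∈ (walk j z φ).freeVars
        · exact ⟨s, fun _ _ => rfl, hs _ h0 _ hk⟩
        · refine ⟨Function.update s (z (Fin.last k)) (s (z 0)), fun x hx => ?_, ?_⟩
          · rw [Function.update_of_ne (fun h => hk (by rwa [← h]))]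
          · rw [Function.update_self, Function.update_of_ne (fun h => hk (by rwa [← h]))]
            exact diag_ne_horizontalEdge (by omega) _
      · refine ⟨Function.update s (z 0) (s (z (Fin.last k))), fun x hx => ?_, ?_⟩
        · rw [Function.update_of_ne (fun h => h0 (by rwa [← h]))]
        · rw [Function.update_self]
          by_cases hk : z (Fin.last k) = z 0
          · rw [hk, Function.update_self]
            exact diag_ne_horizontalEdge (by omega) _
          · rw [Function.update_of_ne hk]
            exact diag_ne_horizontalEdge (by omega) _
    rw [realize_congr _ _ hwf s t hst, realize_congr _ _ hwf (fun x => F.act (s x))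
      (fun x => F.act (t x)) fun x hx => by rw [hst x hx]]
    obtain ⟨q, rfl⟩ : ∃ q', q = q' + 1 := ⟨q - 1, by simp only [quantifierDepth] at hq; omega⟩
    have hφq : ∀ l, (φ l).quantifierDepth ≤ q := fun l =>
      (Finset.le_sup (f := fun l => (φ l).quantifierDepth) (Finset.mem_univ l)).trans
        (Nat.le_of_succ_le_succ hq)
    obtain ⟨i', hi', hi'', ⟨M, hM, hMS⟩, hoff⟩ :=
      exists_canMove_offSquare (by omega) (by omega) ht
    have hin' : i' + 1 < n := by omega
    obtain ⟨r', hr⟩ : ∃ r' : Fin 2, r ≠ r' := exists_ne r |>.imp fun _ h => h.symm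
    have hne : horizontalEdge n r i' ≠ horizontalEdge n r' i' := by
      have h0 : i' < n := by omega
      simp [horizontalEdge, gridPoint_inj h0 h0, gridPoint_inj h0 hin', hr]
    obtain ⟨P, hP, hPS⟩ := canMove_horizontalEdge_of_col hr hin' (Or.inr rfl)
    obtain ⟨P', hP', hPS'⟩ := canMove_horizontalEdge_of_col hr hin' (Or.inl rfl)
    have hoffP : ∀ w, OffSquare n i' w → P.toFun w = P'.toFun w := by
      intro w hw
      funext f
      rw [hPS w (by simp [(hw r).2, (hw r').2]), hPS' w (by simp [(hw r).1, (hw r').1])]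
    have hFM : ∀ w, w = (t (z 0)).origin ∨ w = (t (z (Fin.last k))).origin →
        (F.comp M).toFun w = F.toFun w := by
      intro w hw
      funext f
      rw [comp_toFun, hMS w (by simp only [Set.mem_ofPred_eq]; tauto), Bool.xor_false]
    refine realize_walk_iff fun o => ?_
    obtain ⟨Φ, hΦ0, hΦk, hΦ⟩ := (hF.comp hM).exists_reroute hP hP' hne rfl
      (hPS _ (by
        have h0 : i' < n := by omega
        simp [gridPoint_inj h0 hin']))
      (hPS' _ (by
        have h0 : i' < n := by omega
        simp [gridPoint_inj hin' h0])) (hoff.imp (hoffP _) (hoffP _)) o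
    refine ⟨Φ, fun h => (hΦ0 h).trans (hFM _ (Or.inl rfl)),
      fun h => (hΦk h).trans (hFM _ (Or.inr rfl)), fun l w hw => ?_⟩
    obtain ⟨F', e', he', hF', hle', h1, h2⟩ := hΦ l
    obtain ⟨r'', rfl⟩ : ∃ r'', e' = horizontalEdge n r'' i' :=
      he'.elim (fun h => ⟨r, h⟩) fun h => ⟨r', h⟩
    have hfree : ∀ x ∈ (φ l).freeVars, z.symm x = l.castSucc ∨ z.symm x = l.succ := by
      intro x hx
      rcases (hwf l).2 hx with rfl | rfl <;> simp
    rw [ih l (hwf l).1 q i' r'' F' (fun x => w (z.symm x)) (hφq l) (by omega) (by omega) hF' ?_]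
    · refine realize_congr _ _ (hwf l).1 _ _ fun x hx => act_congr ?_
      rcases hfree x hx with h | h <;> simp only [h, hw, h1, h2]
    · intro x hx y hy
      rcases hfree x hx with h | h <;> rcases hfree y hy with h' | h' <;>
        simp only [h, h', hw]
      · exact diag_ne_horizontalEdge hin' _
      · exact hle'
      · rw [Sym2.eq_swap]
        exact hle'
      · exact diag_ne_horizontalEdge hin' _

end WalkFormula

theorem mainTheorem8 :
    ∃ c : ℝ, 0 < c ∧
      ∀ n : ℕ, 3 ≤ n → ∀ e : (gridWithTail n).edgeSet,
        ∀ (k : ℕ) (φ : WalkFormula k),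
          φ.Distinguishes (cfiGraph (gridWithTail n)) (twistedCFIGraph (gridWithTail n) e) →
            c * n ≤ φ.quantifierDepth := by
  refine ⟨1 / 3, by norm_num, fun n hn e k φ ⟨⟨hwf, hfree⟩, hφ⟩ => ?_⟩
  by_contra hlt
  have hlt' : 3 * φ.quantifierDepth < n := by
    have : (3 * φ.quantifierDepth : ℝ) < n := by linarith
    exact_mod_cast this
  obtain ⟨F, hF, -⟩ := canMove_univ_horizontalEdge (n := n) (i := φ.quantifierDepth) (r := 0)
    (by omega) e
  have key := fun s => φ.realize_flip_iff hwf φ.quantifierDepth φ.quantifierDepth 0 F s le_rfl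
    le_rfl (by omega) hF (by simp [hfree])
  refine hφ ⟨fun h s => ?_, fun h s => (key s).2 (h _)⟩
  simpa using (key fun x => F.act (s x)).1 (h _)
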